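/- Conventions. Let $d\geq 1$, let $\mathbf S_d^+$ be the set of real symmetric nonnegative-definite $d\times d$ matrices, and identify $s\in\mathbf S_d^+$ with its lower triangle $(s_{jk})_{k\le j}\in\mathbb R^{d(d+1)/2}$, so that the law of an $\mathbf S_d^+$-valued random variable is a distribution on $\mathbb R^{d(d+1)/2}$. Write $\widehat\mu$ for the characteristic function of $\mu$ and $ID(\mathbb R^n)$ for the class of infinitely divisible distributions on $\mathbb R^n$. For $b>1$, $L_0(b^{-1},\mathbb R^n)$ is the class of distributions $\mu$ on $\mathbb R^n$ for which there is $\mu'\in ID(\mathbb R^n)$ with $\widehat\mu(z)=\widehat\mu(b^{-1}z)\,\widehat{\mu'}(z)$ for all $z\in\mathbb R^n$ ($\mu'$ is then unique); for $m=1,2,\dots$, $L_m(b^{-1},\mathbb R^n)$ is the class of $\mu\in L_0(b^{-1},\mathbb R^n)$ with $\mu'\in L_{m-1}(b^{-1},\mathbb R^n)$; and $L_\infty(b^{-1},\mathbb R^n)=\bigcap_{m=0}^\infty L_m(b^{-1},\mathbb R^n)$. For $0<\alpha\le 2$ and $b>1$, a distribution $\mu$ on $\mathbb R^n$ is strictly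 $\alpha$-semistable with a span $b$ if $\mu\in ID(\mathbb R^n)$ and $\widehat\mu(z)^{b^\alpha}=\widehat\mu(bz)$ for all $z\in\mathbb R^n$, where $\widehat\mu(z)^t=e^{t\psi(z)}$ with $\psi$ the continuous function such that $\psi(0)=0$ and $e^{\psi}=\widehat\mu$. Proposition. Let $\sigma$ be a distribution of type mult$G$, that is, $\sigma=\mathcal L(Z^{1/2}X)$, where $X$ is a standard Gaussian random vector on $\mathbb R^d$, $Z$ is an $\mathbf S_d^+$-valued random variable whose law is infinitely divisible, $Z^{1/2}$ is the nonnegative-definite symmetric square root of $Z$, and $X$ and $Z$ are independent. (i) Let $m\in\{0,1,\dots,\infty\}$ and $b>1$. If $\mathcal L(Z)\in L_m(b^{-1},\mathbb R^{d(d+1)/2})$, then $\sigma\in L_m(b^{-1/2},\mathbb R^d)$. (ii) Let $0<\alpha'\le 1$ and $b>1$. If $\mathcal L(Z)$ is strictly $\alpha'$-semistable with a span $b$, then $\sigma$ is strictly $2\alpha'$-semistable with a span $b^{1/2}$. -/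

import Mathlib

open MeasureTheory ProbabilityTheory
open scoped MatrixOrder

noncomputable section

/-- The `n`-fold convolution power of a measure on an additive monoid. -/
def convPow {E : Type*} [AddMonoid E] [MeasurableSpace E] (ν : Measure E) : ℕ → Measure E
  | 0 => Measure.dirac 0
  | n + 1 => (convPow ν n).conv ν

/-- `μ` is an infinitely divisible probability distribution: for every `n ≥ 1` it is the `n`-fold
convolution power of some probability distribution. -/
def IsInfDivisible {E : Type*} [AddMonoid E] [MeasurableSpace E] (μ : Measure E) : Prop :=
  IsProbabilityMeasure μ ∧
    ∀ n : ℕ, 1 ≤ n → ∃ ν : Measure E, IsProbabilityMeasure ν ∧ μ = convPow ν n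

section

variable {E : Type*} [NormedAddCommGroup E] [InnerProductSpace ℝ E] [MeasurableSpace E]

/-- The decomposition `μ̂(z) = μ̂(c z) μ̂'(z)` for all `z`, where `c = b⁻¹`. -/
def IsSemiDecomp (c : ℝ) (μ μ' : Measure E) : Prop :=
  ∀ z : E, charFun μ z = charFun μ (c • z) * charFun μ' z

/-- The class `L₀(c, E)` of semi-selfdecomposable distributions with span `b = c⁻¹ > 1`
(that is, `0 < c < 1`). -/
def IsSemiSelfdecomposable (c : ℝ) (μ : Measure E) : Prop :=
  (0 < c ∧ c < 1) ∧ IsProbabilityMeasure μ ∧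
    ∃ μ' : Measure E, IsInfDivisible μ' ∧ IsSemiDecomp c μ μ'

variable (E) in
/-- The classes `L_m(c, E)`, `m = 0, 1, 2, …`. The factor `μ'` is uniquely determined by `μ` and
`c` when `μ` is in `L₀(c, E)`, so that `∃ μ'` says that the factor `μ'` is in the previous class. -/
def finiteClassL (c : ℝ) : ℕ → Set (Measure E)
  | 0 => {μ | IsSemiSelfdecomposable c μ}
  | m + 1 => {μ | IsSemiSelfdecomposable c μ ∧
      ∃ μ' : Measure E, IsInfDivisible μ' ∧ IsSemiDecomp c μ μ' ∧ μ' ∈ finiteClassL c m}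

variable (E) in
/-- The classes `L_m(c, E)` for `m ∈ {0, 1, …, ∞}`, with `L_∞(c, E)` the intersection of all
`L_m(c, E)`, `m` finite. -/
def classL (m : ℕ∞) (c : ℝ) : Set (Measure E) :=
  ENat.recTopCoe (C := fun _ => Set (Measure E))
    (⋂ k : ℕ, finiteClassL E c k) (fun k : ℕ => finiteClassL E c k) m

/-- `ψ` is the distinguished logarithm of the characteristic function of `μ`, i.e. the continuous
function with `ψ 0 = 0` and `exp ψ = μ̂`. It is unique, and it exists when `μ` is infinitely
divisible on a Euclidean space; `μ̂(z) ^ t` then means `exp (t ψ(z))`. -/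
def IsDistinguishedLog (μ : Measure E) (ψ : E → ℂ) : Prop :=
  Continuous ψ ∧ ψ 0 = 0 ∧ ∀ z : E, Complex.exp (ψ z) = charFun μ z

/-- `μ` is strictly `α`-semistable with a span `b`: here `0 < α ≤ 2`, `b > 1`, `μ` is infinitely
divisible and `μ̂(z) ^ (b ^ α) = μ̂(b z)` for all `z`. -/
def IsStrictlySemistable (α b : ℝ) (μ : Measure E) : Prop :=
  (0 < α ∧ α ≤ 2) ∧ 1 < b ∧ IsInfDivisible μ ∧
    ∃ ψ : E → ℂ, IsDistinguishedLog μ ψ ∧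
      ∀ z : E, Complex.exp (((b ^ α : ℝ) : ℂ) * ψ z) = charFun μ (b • z)

end

/-- Positions `(j, k)`, `k ≤ j`, in the lower triangle of a `d × d` matrix. -/
abbrev LowerIdx (d : ℕ) : Type := {p : Fin d × Fin d // p.2 ≤ p.1}

/-- The Euclidean space of lower triangles, of dimension `d (d + 1) / 2`. -/
abbrev LowerSpace (d : ℕ) : Type := EuclideanSpace ℝ (LowerIdx d)

theorem card_lowerIdx (d : ℕ) : Fintype.card (LowerIdx d) = d * (d + 1) / 2 := by
  have h : Fintype.card (LowerIdx d) = ∑ j : Fin d, (j.val + 1) := by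
    rw [Fintype.card_subtype, Finset.card_filter, Fintype.sum_prod_type]
    refine Finset.sum_congr rfl fun j _ => ?_
    rw [← Finset.card_filter]
    have : (Finset.univ.filter fun k : Fin d => k ≤ j) = Finset.Iic j := by
      ext k; simp
    rw [this, Fin.card_Iic]
  have h2 := Finset.sum_range_succ' (fun j => j) d
  rw [h, Fin.sum_univ_eq_sum_range (fun j => j + 1) d]
  rw [Finset.sum_range_id] at h2
  rw [Nat.add_sub_cancel, Nat.mul_comm] at h2
  simpa using h2.symm

/-- The lower triangle of a matrix, as a vector. -/
def lowerTriangle {d : ℕ} (s : Matrix (Fin d) (Fin d) ℝ) : LowerSpace d :=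
  WithLp.toLp 2 fun p : LowerIdx d => s p.1.1 p.1.2

end

/-!
Write `μ` for the law of (the lower triangle of) `Z`. Conditioning on `Z` shows that the
characteristic function of `σ` at `z` is `∫ exp (-zᵀ S z / 2) dμ(S)`, the Laplace transform of `μ`
at `z zᵀ / 2` (`charFun_gaussianMixture`). On laws concentrated on the cone of nonnegative-definite
matrices this transform turns convolutions into products, and scaling `μ` by `r ≥ 0` amounts to
scaling `z` by `√r`. Hence relations between mixing laws carry over to the mixtures, provided that
all the laws involved are concentrated on the cone.

That proviso is checked on the half-spaces `{S | 0 ≤ zᵀ S z}`, countably many of which cut out the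
cone. A convolution root of a nonnegative law is nonnegative (`ae_nonneg_of_convPow`). If `T ≥ 0`
has the law of `c T + T'` with independent summands and `0 < c < 1`, then `T' ≥ 0`, by comparison of
essential infima (`ae_nonneg_of_semiDecomp`). The first fact gives infinite divisibility of `σ`; the
second gives the classes `L_m`, by induction on `m`.

For semistability, the Laplace transform is positive, so the distinguished logarithm of `σ` is its
real logarithm. What remains is to pass from `μ̂(z) ^ a = μ̂(b z)` to the same relation between
Laplace transforms. This avoids analytic continuation: the laws `ν_n ^ {*⌊a n⌋}`, where `ν_n` is the
`n`-th convolution root of `μ`, converge weakly to the law of `b Z` by Lévy's theorem, and their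
Laplace transforms are explicit powers of that of `μ` (`laplace_rpow_eq`).
-/

noncomputable section

open Filter Topology Matrix

/-! ### Convolution and essential positivity of linear functionals -/

lemma measure_setOf_lt_pos_iff {E : Type*} [MeasurableSpace E] {μ : Measure E} {f : E → ℝ}
    {t : ℝ} : 0 < μ {x | f x < t} ↔ ¬ ∀ᵐ x ∂μ, t ≤ f x := by
  rw [ae_iff, pos_iff_ne_zero]
  simp

section Convolution

variable {E : Type*} [AddCommGroup E] [MeasurableSpace E] [MeasurableAdd₂ E]

instance isProbabilityMeasure_convPow (ν : Measure E) [IsProbabilityMeasure ν] (n : ℕ) :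
    IsProbabilityMeasure (convPow ν n) := by
  induction n with
  | zero => exact Measure.dirac.isProbabilityMeasure
  | succ n ih => rw [convPow]; infer_instance

lemma conv_setOf_lt_pos {μ ν : Measure E} [SFinite μ] [SFinite ν] {f : E → ℝ} (hf : Measurable f)
    (hadd : ∀ x y, f (x + y) = f x + f y) {s t : ℝ}
    (hμ : 0 < μ {x | f x < s}) (hν : 0 < ν {x | f x < t}) :
    0 < (μ.conv ν) {x | f x < s + t} := by
  have hm : MeasurableSet {x | f x < s + t} := measurableSet_lt hf measurable_const
  rw [Measure.conv, Measure.map_apply measurable_add hm]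
  have hsub : {x | f x < s} ×ˢ {x | f x < t} ⊆
      (fun p : E × E ↦ p.1 + p.2) ⁻¹' {x | f x < s + t} := by
    rintro ⟨x, y⟩ ⟨hx, hy⟩
    simp only [Set.mem_ofPred_eq, Set.mem_preimage, hadd] at hx hy ⊢
    exact add_lt_add hx hy
  refine lt_of_lt_of_le ?_ (measure_mono hsub)
  rw [Measure.prod_prod]
  exact ENNReal.mul_pos hμ.ne' hν.ne'

/-- If a sum of independent copies is almost surely nonnegative, then so is each copy. -/
lemma ae_nonneg_of_convPow {ν : Measure E} [IsProbabilityMeasure ν] {f : E → ℝ}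
    (hf : Measurable f) (hadd : ∀ x y, f (x + y) = f x + f y) {n : ℕ} (hn : 1 ≤ n)
    (h : ∀ᵐ x ∂(convPow ν n), 0 ≤ f x) : ∀ᵐ x ∂ν, 0 ≤ f x := by
  by_contra hν
  rw [← measure_setOf_lt_pos_iff] at hν
  have key : ∀ k, 0 < convPow ν (k + 1) {x | f x < 0} := by
    intro k
    induction k with
    | zero => simpa [convPow] using hν
    | succ k ih =>
      rw [convPow]
      simpa using conv_setOf_lt_pos hf hadd ih hν
  obtain ⟨k, rfl⟩ := Nat.exists_eq_add_of_le' hn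
  exact measure_setOf_lt_pos_iff.1 (key k) h

/-- If `T` has the law of `c T + T'` with independent summands, `0 < c < 1` and `T ≥ 0`, then
`T' ≥ 0`: were `T' < -δ` with positive probability, a lower bound `t ≥ 0` of `T` would improve to
`(t + δ) / c`, and `T` would have no finite essential infimum. -/
lemma ae_nonneg_of_semiDecomp [Module ℝ E] [MeasurableConstSMul ℝ E] {c : ℝ} (hc0 : 0 < c)
    (hc1 : c < 1) {μ μ' : Measure E} [IsProbabilityMeasure μ] [IsProbabilityMeasure μ']
    (hμ : μ = (μ.map (c • ·)).conv μ') {f : E → ℝ}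
    (hf : Measurable f) (hadd : ∀ x y, f (x + y) = f x + f y)
    (hsmul : ∀ x, f (c • x) = c * f x)
    (h : ∀ᵐ x ∂μ, 0 ≤ f x) : ∀ᵐ x ∂μ', 0 ≤ f x := by
  have step : ∀ δ > 0, ∀ᵐ x ∂μ', -δ ≤ f x := by
    intro δ hδ
    by_contra hneg
    rw [← measure_setOf_lt_pos_iff] at hneg
    -- As `c < 1`, the improved bound `(t + δ) / c` may be weakened to `t + δ`.
    have hiter : ∀ n : ℕ, ∀ᵐ x ∂μ, n * δ ≤ f x := by
      intro n
      induction n with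
      | zero => simpa using h
      | succ n ih =>
        by_contra hnot
        rw [← measure_setOf_lt_pos_iff] at hnot
        refine measure_setOf_lt_pos_iff.1 ?_ ih
        have hscaled : 0 < (μ.map (c • ·)) {x | f x < (n + 1) * δ} := by
          rw [Measure.map_apply (measurable_const_smul c)
            (measurableSet_lt hf measurable_const)]
          refine hnot.trans_le (measure_mono fun x hx ↦ ?_)
          simp only [Set.mem_ofPred_eq, Set.mem_preimage, hsmul, Nat.cast_add, Nat.cast_one]
            at hx ⊢
          have hpos : 0 < ((n : ℝ) + 1) * δ := by positivity
          nlinarith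
        have hconv := conv_setOf_lt_pos hf hadd hscaled hneg
        rw [← hμ] at hconv
        rwa [show ((n : ℝ) + 1) * δ + -δ = n * δ by ring] at hconv
    have hall : ∀ᵐ x ∂μ, ∀ n : ℕ, n * δ ≤ f x := ae_all_iff.2 hiter
    obtain ⟨x, hx⟩ := hall.exists
    obtain ⟨n, hn⟩ := exists_nat_gt (f x / δ)
    rw [div_lt_iff₀ hδ] at hn
    exact absurd (hx n) (not_le.2 hn)
  have hall : ∀ᵐ x ∂μ', ∀ n : ℕ, -(1 / ((n : ℝ) + 1)) ≤ f x :=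
    ae_all_iff.2 fun n ↦ step _ (by positivity)
  filter_upwards [hall] with x hx
  by_contra! hneg
  obtain ⟨n, hn⟩ := exists_nat_one_div_lt (neg_pos.2 hneg)
  linarith [hx n]

lemma ae_conv_of_ae {μ ν : Measure E} [SFinite μ] [SFinite ν] {p : E → Prop}
    (hp : MeasurableSet {x | p x}) (hadd : ∀ x y, p x → p y → p (x + y))
    (hμ : ∀ᵐ x ∂μ, p x) (hν : ∀ᵐ x ∂ν, p x) : ∀ᵐ x ∂(μ.conv ν), p x := by
  rw [Measure.conv, ae_map_iff (by fun_prop) hp]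
  have h1 : ∀ᵐ q ∂(μ.prod ν), p q.1 := Measure.quasiMeasurePreserving_fst.ae hμ
  have h2 : ∀ᵐ q ∂(μ.prod ν), p q.2 := Measure.quasiMeasurePreserving_snd.ae hν
  filter_upwards [h1, h2] with q hq1 hq2 using hadd _ _ hq1 hq2

end Convolution

section CharFun

variable {E : Type*} [NormedAddCommGroup E] [InnerProductSpace ℝ E] [MeasurableSpace E]
  [BorelSpace E] [SecondCountableTopology E]

lemma charFun_convPow (ν : Measure E) [IsProbabilityMeasure ν] (n : ℕ) (z : E) :
    charFun (convPow ν n) z = charFun ν z ^ n := by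
  induction n with
  | zero => simp [convPow]
  | succ n ih => rw [convPow, charFun_conv, ih, pow_succ]

lemma IsSemiDecomp.eq_conv [CompleteSpace E] {c : ℝ} {μ μ' : Measure E} [IsProbabilityMeasure μ]
    [IsProbabilityMeasure μ'] (h : IsSemiDecomp c μ μ') : μ = (μ.map (c • ·)).conv μ' := by
  have : IsProbabilityMeasure (μ.map (c • ·)) :=
    Measure.isProbabilityMeasure_map (by fun_prop)
  refine Measure.ext_of_charFun ?_
  ext z
  rw [charFun_conv, charFun_map_smul, h z]

/-- The `n`-th convolution root of `μ` has characteristic function `exp (ψ / n)`: the quotient of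
the two is continuous with values in the finite set of `n`-th roots of unity. -/
lemma charFun_root_eq {μ ν : Measure E} [IsProbabilityMeasure ν] {n : ℕ} (hn : n ≠ 0)
    (hμ : μ = convPow ν n) {ψ : E → ℂ} (hψ : IsDistinguishedLog μ ψ) (z : E) :
    charFun ν z = Complex.exp (ψ z / n) := by
  obtain ⟨hcont, h0, hexp⟩ := hψ
  have hn' : (n : ℂ) ≠ 0 := Nat.cast_ne_zero.2 hn
  let q : E → ℂ := fun z ↦ charFun ν z * Complex.exp (-(ψ z / n))
  have hq : Continuous q := by
    have := continuous_charFun (μ := ν)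
    fun_prop
  have hroot : ∀ z, q z ∈ {w : ℂ | w ^ n = 1} := by
    intro z
    have h1 : charFun ν z ^ n = Complex.exp (ψ z) := by rw [hexp, hμ, charFun_convPow]
    simp only [q, Set.mem_ofPred_eq, mul_pow, h1, ← Complex.exp_nat_mul, ← Complex.exp_add]
    rw [mul_neg, mul_div_cancel₀ _ hn', add_neg_cancel, Complex.exp_zero]
  have hfin : {w : ℂ | w ^ n = 1}.Finite := by
    refine (Polynomial.nthRootsFinset n (1 : ℂ)).finite_toSet.subset fun w hw ↦ ?_
    exact (Polynomial.mem_nthRootsFinset (Nat.pos_of_ne_zero hn) 1).2 hw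
  have hconst := isPreconnected_univ.constant_of_mapsTo (T := {w : ℂ | w ^ n = 1})
    hfin.isDiscrete hq.continuousOn (fun z _ ↦ hroot z) (Set.mem_univ z) (Set.mem_univ 0)
  have hq0 : q 0 = 1 := by simp [q, h0]
  rw [hq0] at hconst
  simp only [q, Complex.exp_neg] at hconst
  exact (mul_inv_eq_one₀ (Complex.exp_ne_zero _)).1 hconst

end CharFun

/-! ### Symmetric matrices in lower-triangle coordinates -/

variable {d : ℕ}

/-- The symmetric matrix with a given lower triangle, the inverse of `lowerTriangle` on symmetric
matrices. -/
def symMatrix (s : LowerSpace d) : Matrix (Fin d) (Fin d) ℝ :=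
  Matrix.of fun i j ↦ s ⟨(max i j, min i j), min_le_max⟩

/-- The quadratic form `zᵀ S z` of the symmetric matrix `S` with lower triangle `s`. -/
def quadForm (z : EuclideanSpace ℝ (Fin d)) (s : LowerSpace d) : ℝ :=
  z ⬝ᵥ symMatrix s *ᵥ z

lemma symMatrix_lowerTriangle {S : Matrix (Fin d) (Fin d) ℝ} (hS : S.IsHermitian) :
    symMatrix (lowerTriangle S) = S := by
  ext i j
  rcases le_total i j with h | h
  · simpa [symMatrix, lowerTriangle, h] using hS.apply i j
  · simp [symMatrix, lowerTriangle, h]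

lemma isHermitian_symMatrix (s : LowerSpace d) : (symMatrix s).IsHermitian := by
  ext i j
  simp only [symMatrix, conjTranspose_apply, of_apply, star_trivial, max_comm j i, min_comm j i]

lemma continuous_symMatrix : Continuous (symMatrix (d := d)) := by
  refine continuous_matrix fun i j ↦ ?_
  simp only [symMatrix, of_apply]
  fun_prop

lemma quadForm_eq_sum (z : EuclideanSpace ℝ (Fin d)) (s : LowerSpace d) :
    quadForm z s = ∑ i, ∑ j, z i * (symMatrix s i j * z j) := by
  simp [quadForm, dotProduct, mulVec, Finset.mul_sum]

lemma continuous_quadForm_uncurry :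
    Continuous fun p : EuclideanSpace ℝ (Fin d) × LowerSpace d ↦ quadForm p.1 p.2 := by
  simp only [quadForm_eq_sum, symMatrix, of_apply]
  fun_prop

lemma continuous_quadForm (z : EuclideanSpace ℝ (Fin d)) : Continuous (quadForm z) :=
  continuous_quadForm_uncurry.comp (Continuous.prodMk_right z)

lemma quadForm_add (z : EuclideanSpace ℝ (Fin d)) (s t : LowerSpace d) :
    quadForm z (s + t) = quadForm z s + quadForm z t := by
  simp only [quadForm_eq_sum, symMatrix, of_apply, PiLp.add_apply, ← Finset.sum_add_distrib]
  refine Finset.sum_congr rfl fun i _ ↦ Finset.sum_congr rfl fun j _ ↦ ?_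
  ring

lemma quadForm_smul (z : EuclideanSpace ℝ (Fin d)) (r : ℝ) (s : LowerSpace d) :
    quadForm z (r • s) = r * quadForm z s := by
  simp only [quadForm_eq_sum, symMatrix, of_apply, PiLp.smul_apply, smul_eq_mul, Finset.mul_sum]
  refine Finset.sum_congr rfl fun i _ ↦ Finset.sum_congr rfl fun j _ ↦ ?_
  ring

lemma quadForm_smul_left (r : ℝ) (z : EuclideanSpace ℝ (Fin d)) (s : LowerSpace d) :
    quadForm (r • z) s = r ^ 2 * quadForm z s := by
  simp only [quadForm_eq_sum, PiLp.smul_apply, smul_eq_mul, Finset.mul_sum]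
  refine Finset.sum_congr rfl fun i _ ↦ Finset.sum_congr rfl fun j _ ↦ ?_
  ring

lemma posSemidef_symMatrix_iff {s : LowerSpace d} :
    (symMatrix s).PosSemidef ↔ ∀ z, 0 ≤ quadForm z s := by
  constructor
  · intro h z
    simpa [quadForm] using h.dotProduct_mulVec_nonneg z
  · intro h
    refine .of_dotProduct_mulVec_nonneg (isHermitian_symMatrix s) fun x ↦ ?_
    simpa [quadForm] using h (WithLp.toLp 2 x)

/-- The lower triangles of nonnegative-definite matrices, a closed convex cone. -/
def psdCone (d : ℕ) : Set (LowerSpace d) := {s | (symMatrix s).PosSemidef}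

lemma isClosed_psdCone : IsClosed (psdCone d) := by
  have : psdCone d = ⋂ z, {s | 0 ≤ quadForm z s} := by
    ext s
    simp [psdCone, posSemidef_symMatrix_iff]
  rw [this]
  exact isClosed_iInter fun z ↦ isClosed_le continuous_const (continuous_quadForm z)

lemma add_mem_psdCone {s t : LowerSpace d} (hs : s ∈ psdCone d) (ht : t ∈ psdCone d) :
    s + t ∈ psdCone d := by
  refine posSemidef_symMatrix_iff.2 fun z ↦ ?_
  rw [quadForm_add]
  exact add_nonneg (posSemidef_symMatrix_iff.1 hs z) (posSemidef_symMatrix_iff.1 ht z)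

lemma smul_mem_psdCone {r : ℝ} (hr : 0 ≤ r) {s : LowerSpace d} (hs : s ∈ psdCone d) :
    r • s ∈ psdCone d := by
  refine posSemidef_symMatrix_iff.2 fun z ↦ ?_
  rw [quadForm_smul]
  exact mul_nonneg hr (posSemidef_symMatrix_iff.1 hs z)

lemma zero_mem_psdCone : (0 : LowerSpace d) ∈ psdCone d := by
  refine posSemidef_symMatrix_iff.2 fun z ↦ ?_
  simpa using (quadForm_smul z 0 0).ge

/-- A measure is concentrated on the cone as soon as each quadratic form is almost surely
nonnegative, since countably many half-spaces cut out the cone. -/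
lemma ae_mem_psdCone {μ : Measure (LowerSpace d)} (h : ∀ z, ∀ᵐ s ∂μ, 0 ≤ quadForm z s) :
    ∀ᵐ s ∂μ, s ∈ psdCone d := by
  have hall : ∀ᵐ s ∂μ, ∀ n : ℕ,
      0 ≤ quadForm (TopologicalSpace.denseSeq (EuclideanSpace ℝ (Fin d)) n) s :=
    ae_all_iff.2 fun n ↦ h _
  filter_upwards [hall] with s hs
  refine posSemidef_symMatrix_iff.2 fun z ↦ ?_
  have hcl : IsClosed {z | 0 ≤ quadForm z s} :=
    isClosed_le continuous_const (continuous_quadForm_uncurry.comp (Continuous.prodMk_left s))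
  refine (TopologicalSpace.denseRange_denseSeq _).induction_on
    (p := fun z ↦ 0 ≤ quadForm z s) z hcl hs

lemma ae_mem_psdCone_conv {μ ν : Measure (LowerSpace d)} [SFinite μ] [SFinite ν]
    (hμ : ∀ᵐ s ∂μ, s ∈ psdCone d) (hν : ∀ᵐ s ∂ν, s ∈ psdCone d) :
    ∀ᵐ s ∂(μ.conv ν), s ∈ psdCone d :=
  ae_conv_of_ae isClosed_psdCone.measurableSet (fun _ _ ↦ add_mem_psdCone) hμ hν

lemma ae_mem_psdCone_convPow {ν : Measure (LowerSpace d)} [IsProbabilityMeasure ν]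
    (hν : ∀ᵐ s ∂ν, s ∈ psdCone d) (n : ℕ) : ∀ᵐ s ∂(convPow ν n), s ∈ psdCone d := by
  induction n with
  | zero =>
    rw [convPow, ae_dirac_iff (p := fun s ↦ s ∈ psdCone d) isClosed_psdCone.measurableSet]
    exact zero_mem_psdCone
  | succ n ih => exact ae_mem_psdCone_conv ih hν

lemma ae_mem_psdCone_map_smul {μ : Measure (LowerSpace d)} {r : ℝ} (hr : 0 ≤ r)
    (hμ : ∀ᵐ s ∂μ, s ∈ psdCone d) : ∀ᵐ s ∂(μ.map (r • ·)), s ∈ psdCone d := by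
  rw [ae_map_iff (p := fun s ↦ s ∈ psdCone d) (by fun_prop) isClosed_psdCone.measurableSet]
  filter_upwards [hμ] with s hs using smul_mem_psdCone hr hs

lemma ae_mem_psdCone_root {ν : Measure (LowerSpace d)} [IsProbabilityMeasure ν] {n : ℕ}
    (hn : 1 ≤ n) (h : ∀ᵐ s ∂(convPow ν n), s ∈ psdCone d) : ∀ᵐ s ∂ν, s ∈ psdCone d :=
  ae_mem_psdCone fun z ↦ ae_nonneg_of_convPow (continuous_quadForm z).measurable
    (quadForm_add z) hn (h.mono fun _ hs ↦ posSemidef_symMatrix_iff.1 hs z)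

/-- The factor of a semi-selfdecomposable law on the cone is itself concentrated on the cone. -/
lemma ae_mem_psdCone_of_semiDecomp {c : ℝ} (hc0 : 0 < c) (hc1 : c < 1)
    {μ μ' : Measure (LowerSpace d)} [IsProbabilityMeasure μ] [IsProbabilityMeasure μ']
    (h : IsSemiDecomp c μ μ') (hμ : ∀ᵐ s ∂μ, s ∈ psdCone d) : ∀ᵐ s ∂μ', s ∈ psdCone d :=
  ae_mem_psdCone fun z ↦ ae_nonneg_of_semiDecomp hc0 hc1 h.eq_conv
    (continuous_quadForm z).measurable (quadForm_add z) (quadForm_smul z c)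
    (hμ.mono fun _ hs ↦ posSemidef_symMatrix_iff.1 hs z)

/-! ### Gaussian mixtures -/

open scoped Matrix.Norms.L2Operator in
lemma continuousOn_sqrt_posSemidef :
    ContinuousOn (CFC.sqrt : Matrix (Fin d) (Fin d) ℝ → _) {S | S.PosSemidef} := by
  have h := CFC.continuousOn_sqrt (A := Matrix (Fin d) (Fin d) ℝ)
  simpa only [nonneg_iff_posSemidef] using h

lemma sqrt_eq_zero_of_not_posSemidef {S : Matrix (Fin d) (Fin d) ℝ} (hS : ¬ S.PosSemidef) :
    CFC.sqrt S = 0 :=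
  CFC.sqrt_of_not_nonneg fun h ↦ hS (nonneg_iff_posSemidef.1 h)

lemma measurable_sqrt_symMatrix (i j : Fin d) :
    Measurable fun s : LowerSpace d ↦ CFC.sqrt (symMatrix s) i j := by
  refine measurable_of_restrict_of_restrict_compl
    (isClosed_psdCone (d := d)).measurableSet ?_ ?_
  · refine Continuous.measurable (continuousOn_iff_continuous_domRestrict.1 ?_)
    exact ((continuous_apply_apply i j).comp_continuousOn
      (continuousOn_sqrt_posSemidef.comp continuous_symMatrix.continuousOn fun s hs ↦ hs))
  · have hzero (s : ((psdCone d)ᶜ : Set (LowerSpace d))) : CFC.sqrt (symMatrix s.1) i j = 0 :=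
      congrFun₂ (sqrt_eq_zero_of_not_posSemidef s.2) i j
    exact measurable_const' fun s t ↦ (hzero s).trans (hzero t).symm

lemma measurable_sqrt_symMatrix_apply :
    Measurable fun p : LowerSpace d × EuclideanSpace ℝ (Fin d) ↦
      Matrix.toEuclideanCLM (𝕜 := ℝ) (CFC.sqrt (symMatrix p.1)) p.2 := by
  refine (WithLp.measurable_toLp 2 (Fin d → ℝ)).comp (measurable_pi_lambda
    (fun p : LowerSpace d × EuclideanSpace ℝ (Fin d) ↦ CFC.sqrt (symMatrix p.1) *ᵥ p.2.ofLp)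
    fun i ↦ ?_)
  simp only [mulVec, dotProduct]
  refine Finset.measurable_sum _ fun j _ ↦ ?_
  exact ((measurable_sqrt_symMatrix i j).comp measurable_fst).mul (by fun_prop)

/-- The Gaussian variance mixture with mixing law `μ`: the law of `S^{1/2} X`, where `X` is
standard Gaussian and the symmetric matrix `S` is independent of `X`, with lower triangle
distributed as `μ`. -/
def gaussianMixture (μ : Measure (LowerSpace d)) : Measure (EuclideanSpace ℝ (Fin d)) :=
  (μ.prod (stdGaussian (EuclideanSpace ℝ (Fin d)))).map fun p ↦
    Matrix.toEuclideanCLM (𝕜 := ℝ) (CFC.sqrt (symMatrix p.1)) p.2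

instance isProbabilityMeasure_gaussianMixture (μ : Measure (LowerSpace d))
    [IsProbabilityMeasure μ] : IsProbabilityMeasure (gaussianMixture μ) :=
  Measure.isProbabilityMeasure_map measurable_sqrt_symMatrix_apply.aemeasurable

/-- The bounded continuous function `exp (-(zᵀ S z)⁺ / 2)` of the lower triangle of `S`. The
positive part is redundant on the cone and ensures boundedness elsewhere. -/
def laplaceKernel (z : EuclideanSpace ℝ (Fin d)) : BoundedContinuousFunction (LowerSpace d) ℝ :=
  .ofNormedAddCommGroup (fun s ↦ Real.exp (-(max 0 (quadForm z s)) / 2))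
    (by have := continuous_quadForm z; fun_prop) 1
    (fun s ↦ by
      rw [Real.norm_of_nonneg (Real.exp_nonneg _), Real.exp_le_one_iff]
      linarith [le_max_left 0 (quadForm z s)])

lemma laplaceKernel_apply (z : EuclideanSpace ℝ (Fin d)) (s : LowerSpace d) :
    laplaceKernel z s = Real.exp (-(max 0 (quadForm z s)) / 2) := rfl

/-- The Laplace transform of a law on the cone, at the points `z zᵀ / 2`. -/
def laplace (μ : Measure (LowerSpace d)) (z : EuclideanSpace ℝ (Fin d)) : ℝ :=
  ∫ s, laplaceKernel z s ∂μ

lemma laplace_pos (μ : Measure (LowerSpace d)) [IsProbabilityMeasure μ]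
    (z : EuclideanSpace ℝ (Fin d)) : 0 < laplace μ z :=
  integral_exp_pos ((laplaceKernel z).integrable μ)

/-- On laws on the cone, the characteristic function of the Gaussian mixture is the Laplace
transform of the mixing law. -/
lemma charFun_gaussianMixture {μ : Measure (LowerSpace d)} [IsProbabilityMeasure μ]
    (hμ : ∀ᵐ s ∂μ, s ∈ psdCone d) (z : EuclideanSpace ℝ (Fin d)) :
    charFun (gaussianMixture μ) z = laplace μ z := by
  have hmeas := measurable_sqrt_symMatrix_apply (d := d)
  rw [charFun_apply, gaussianMixture, integral_map hmeas.aemeasurable (by fun_prop),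
    integral_prod, laplace, ← integral_complex_ofReal]
  · refine integral_congr_ae ?_
    filter_upwards [hμ] with s hs
    have h := charFun_multivariateGaussian (μ := 0) hs z
    rw [charFun_apply, multivariateGaussian, integral_map (by fun_prop) (by fun_prop)] at h
    simp only [zero_add, inner_zero_right, Complex.ofReal_zero, zero_mul, zero_sub] at h
    rw [h, laplaceKernel_apply, max_eq_right (posSemidef_symMatrix_iff.1 hs z), quadForm]
    push_cast
    congr 1
    ring
  · refine Integrable.of_bound (C := 1) ?_ (ae_of_all _ fun p ↦ ?_)
    · refine Measurable.aestronglyMeasurable ?_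
      exact Complex.measurable_exp.comp ((Complex.measurable_ofReal.comp
        (hmeas.inner measurable_const)).mul measurable_const)
    · simp [Complex.norm_exp_ofReal_mul_I]

lemma laplace_map_smul (μ : Measure (LowerSpace d)) {r : ℝ} (hr : 0 ≤ r)
    (z : EuclideanSpace ℝ (Fin d)) :
    laplace (μ.map (r • ·)) z = laplace μ (√r • z) := by
  rw [laplace, integral_map (by fun_prop) (laplaceKernel z).continuous.aestronglyMeasurable]
  simp only [laplace, laplaceKernel_apply, quadForm_smul, quadForm_smul_left, Real.sq_sqrt hr]

lemma laplace_conv {μ ν : Measure (LowerSpace d)} [IsProbabilityMeasure μ]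
    [IsProbabilityMeasure ν] (hμ : ∀ᵐ s ∂μ, s ∈ psdCone d) (hν : ∀ᵐ s ∂ν, s ∈ psdCone d)
    (z : EuclideanSpace ℝ (Fin d)) :
    laplace (μ.conv ν) z = laplace μ z * laplace ν z := by
  rw [laplace, integral_conv ((laplaceKernel z).integrable _), laplace, laplace,
    ← integral_mul_const]
  refine integral_congr_ae ?_
  filter_upwards [hμ] with s hs
  rw [← integral_const_mul]
  refine integral_congr_ae ?_
  filter_upwards [hν] with t ht
  have h1 := posSemidef_symMatrix_iff.1 hs z
  have h2 := posSemidef_symMatrix_iff.1 ht z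
  simp only [laplaceKernel_apply, quadForm_add]
  rw [max_eq_right h1, max_eq_right h2, max_eq_right (add_nonneg h1 h2), ← Real.exp_add]
  congr 1
  ring

lemma laplace_convPow {ν : Measure (LowerSpace d)} [IsProbabilityMeasure ν]
    (hν : ∀ᵐ s ∂ν, s ∈ psdCone d) (n : ℕ) (z : EuclideanSpace ℝ (Fin d)) :
    laplace (convPow ν n) z = laplace ν z ^ n := by
  induction n with
  | zero =>
    have h0 : quadForm z 0 = 0 := by simpa using quadForm_smul z 0 0
    simp [convPow, laplace, laplaceKernel_apply, h0]
  | succ n ih => rw [convPow, laplace_conv (ae_mem_psdCone_convPow hν n) hν, ih, pow_succ]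

lemma gaussianMixture_convPow {ν : Measure (LowerSpace d)} [IsProbabilityMeasure ν]
    (hν : ∀ᵐ s ∂ν, s ∈ psdCone d) (n : ℕ) :
    gaussianMixture (convPow ν n) = convPow (gaussianMixture ν) n := by
  refine Measure.ext_of_charFun ?_
  ext z
  rw [charFun_gaussianMixture (ae_mem_psdCone_convPow hν n), charFun_convPow,
    charFun_gaussianMixture hν, laplace_convPow hν, Complex.ofReal_pow]

lemma IsInfDivisible.gaussianMixture {μ : Measure (LowerSpace d)} (h : IsInfDivisible μ)
    (hμ : ∀ᵐ s ∂μ, s ∈ psdCone d) : IsInfDivisible (gaussianMixture μ) := by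
  obtain ⟨hprob, hroot⟩ := h
  refine ⟨inferInstance, fun n hn ↦ ?_⟩
  obtain ⟨ν, hν, rfl⟩ := hroot n hn
  exact ⟨_, inferInstance, gaussianMixture_convPow (ae_mem_psdCone_root hn hμ) n⟩

/-! ### Semi-selfdecomposability -/

lemma IsSemiDecomp.gaussianMixture {c : ℝ} (hc0 : 0 < c) (hc1 : c < 1)
    {μ μ' : Measure (LowerSpace d)} [IsProbabilityMeasure μ] [IsProbabilityMeasure μ']
    (h : IsSemiDecomp c μ μ') (hμ : ∀ᵐ s ∂μ, s ∈ psdCone d) :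
    IsSemiDecomp √c (gaussianMixture μ) (gaussianMixture μ') := by
  have hμ' := ae_mem_psdCone_of_semiDecomp hc0 hc1 h hμ
  have : IsProbabilityMeasure (μ.map (c • ·)) := Measure.isProbabilityMeasure_map (by fun_prop)
  intro z
  rw [charFun_gaussianMixture hμ, charFun_gaussianMixture hμ, charFun_gaussianMixture hμ',
    ← laplace_map_smul μ hc0.le, ← Complex.ofReal_mul,
    ← laplace_conv (ae_mem_psdCone_map_smul hc0.le hμ) hμ', ← h.eq_conv]

lemma IsSemiSelfdecomposable.gaussianMixture {c : ℝ} {μ : Measure (LowerSpace d)}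
    (h : IsSemiSelfdecomposable c μ) (hμ : ∀ᵐ s ∂μ, s ∈ psdCone d) :
    IsSemiSelfdecomposable √c (gaussianMixture μ) := by
  obtain ⟨⟨hc0, hc1⟩, hprob, μ', hid, hdec⟩ := h
  have := hid.1
  exact ⟨⟨Real.sqrt_pos.2 hc0, by rw [Real.sqrt_lt' one_pos]; simpa using hc1⟩, inferInstance,
    _, hid.gaussianMixture (ae_mem_psdCone_of_semiDecomp hc0 hc1 hdec hμ),
    hdec.gaussianMixture hc0 hc1 hμ⟩

lemma gaussianMixture_mem_finiteClassL {c : ℝ} (m : ℕ) {μ : Measure (LowerSpace d)}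
    (h : μ ∈ finiteClassL (LowerSpace d) c m) (hμ : ∀ᵐ s ∂μ, s ∈ psdCone d) :
    gaussianMixture μ ∈ finiteClassL (EuclideanSpace ℝ (Fin d)) √c m := by
  induction m generalizing μ with
  | zero => exact IsSemiSelfdecomposable.gaussianMixture h hμ
  | succ m ih =>
    obtain ⟨hss, μ', hid, hdec, hmem⟩ := h
    have hprob := hss.2.1
    have := hid.1
    obtain ⟨hc0, hc1⟩ := hss.1
    have hμ' := ae_mem_psdCone_of_semiDecomp hc0 hc1 hdec hμ
    exact ⟨hss.gaussianMixture hμ, _, hid.gaussianMixture hμ',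
      hdec.gaussianMixture hc0 hc1 hμ, ih hmem hμ'⟩

lemma gaussianMixture_mem_classL {c : ℝ} (m : ℕ∞) {μ : Measure (LowerSpace d)}
    (h : μ ∈ classL (LowerSpace d) m c) (hμ : ∀ᵐ s ∂μ, s ∈ psdCone d) :
    gaussianMixture μ ∈ classL (EuclideanSpace ℝ (Fin d)) m √c := by
  induction m using ENat.recTopCoe with
  | top =>
    simp only [classL, ENat.recTopCoe_top, Set.mem_iInter] at h ⊢
    exact fun k ↦ gaussianMixture_mem_finiteClassL k (h k) hμ
  | coe k => exact gaussianMixture_mem_finiteClassL k h hμ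

/-! ### Semistability -/

/-- The relation `μ̂(z) ^ a = μ̂(b z)` between characteristic functions passes to Laplace
transforms. If `ν_n` is the `n`-th root of `μ`, then `ν_n ^ {*⌊a n⌋}` has characteristic function
`exp (⌊a n⌋ ψ / n)`, so that it converges weakly to the law scaled by `b` by Lévy's theorem,
whereas its Laplace transform is the power `⌊a n⌋ / n` of that of `μ`. -/
lemma laplace_rpow_eq {μ : Measure (LowerSpace d)} (hid : IsInfDivisible μ)
    (hμ : ∀ᵐ s ∂μ, s ∈ psdCone d) {ψ : LowerSpace d → ℂ} (hψ : IsDistinguishedLog μ ψ)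
    {a b : ℝ} (ha : 0 ≤ a) (h : ∀ z, Complex.exp (a * ψ z) = charFun μ (b • z))
    (z : EuclideanSpace ℝ (Fin d)) : laplace μ z ^ a = laplace (μ.map (b • ·)) z := by
  obtain ⟨hprob, hroot⟩ := hid
  have hprob' : IsProbabilityMeasure (μ.map (b • ·)) :=
    Measure.isProbabilityMeasure_map (by fun_prop)
  -- `ν n` is the root of order `n + 1`.
  choose ν hν hpow using fun n : ℕ ↦ hroot (n + 1) (by omega)
  have hνpsd : ∀ n, ∀ᵐ s ∂(ν n), s ∈ psdCone d := fun n ↦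
    ae_mem_psdCone_root (n := n + 1) (by omega) (hpow n ▸ hμ)
  let k : ℕ → ℕ := fun n ↦ ⌊a * ((n + 1 : ℕ) : ℝ)⌋₊
  have hlim : Tendsto (fun n : ℕ ↦ (k n : ℝ) / ((n + 1 : ℕ) : ℝ)) atTop (𝓝 a) :=
    ((tendsto_nat_floor_mul_div_atTop ha).comp tendsto_natCast_atTop_atTop).comp
      (tendsto_add_atTop_nat 1)
  let ρ : ℕ → ProbabilityMeasure (LowerSpace d) := fun n ↦ ⟨convPow (ν n) (k n), inferInstance⟩
  let ρ₀ : ProbabilityMeasure (LowerSpace d) := ⟨μ.map (b • ·), hprob'⟩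
  have hweak : Tendsto ρ atTop (𝓝 ρ₀) := by
    refine ProbabilityMeasure.tendsto_of_tendsto_charFun fun w ↦ ?_
    have h1 : ∀ n, charFun (ρ n : Measure (LowerSpace d)) w =
        Complex.exp ((((k n : ℝ) / ((n + 1 : ℕ) : ℝ) : ℝ) : ℂ) * ψ w) := by
      intro n
      change charFun (convPow (ν n) (k n)) w = _
      rw [charFun_convPow, charFun_root_eq n.succ_ne_zero (hpow n) hψ, ← Complex.exp_nat_mul]
      congr 1
      push_cast
      ring
    have h2 : charFun (ρ₀ : Measure (LowerSpace d)) w = Complex.exp (a * ψ w) := by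
      change charFun (μ.map (b • ·)) w = _
      rw [charFun_map_smul, h]
    simp only [h1, h2]
    exact (Complex.continuous_exp.tendsto _).comp
      (((Complex.continuous_ofReal.tendsto a).comp hlim).mul_const _)
  have hlap : ∀ n, laplace (ρ n : Measure (LowerSpace d)) z =
      laplace μ z ^ ((k n : ℝ) / ((n + 1 : ℕ) : ℝ)) := by
    intro n
    have hμν : laplace μ z = laplace (ν n) z ^ (n + 1) := by
      conv_lhs => rw [hpow n]
      exact laplace_convPow (hνpsd n) _ _
    have hpos := laplace_pos (ν n) z
    change laplace (convPow (ν n) (k n)) z = _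
    rw [laplace_convPow (hνpsd n), hμν, ← Real.rpow_natCast, ← Real.rpow_natCast,
      ← Real.rpow_mul hpos.le, mul_div_cancel₀ _ (by positivity)]
  have hlim1 : Tendsto (fun n ↦ laplace (ρ n : Measure (LowerSpace d)) z) atTop
      (𝓝 (laplace (μ.map (b • ·)) z)) :=
    ProbabilityMeasure.tendsto_iff_forall_integral_tendsto.1 hweak (laplaceKernel z)
  have hlim2 : Tendsto (fun n ↦ laplace (ρ n : Measure (LowerSpace d)) z) atTop
      (𝓝 (laplace μ z ^ a)) := by
    simp only [hlap]
    exact (Real.continuousAt_const_rpow (laplace_pos μ z).ne').tendsto.comp hlim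
  exact tendsto_nhds_unique hlim2 hlim1

lemma IsStrictlySemistable.gaussianMixture {α b : ℝ} (hα : α ≤ 1) {μ : Measure (LowerSpace d)}
    (h : IsStrictlySemistable α b μ) (hμ : ∀ᵐ s ∂μ, s ∈ psdCone d) :
    IsStrictlySemistable (2 * α) √b (gaussianMixture μ) := by
  obtain ⟨⟨hα0, -⟩, hb, hid, ψ, hψ, hstable⟩ := h
  have hprob := hid.1
  have hb0 : 0 ≤ b := by linarith
  have hchar := charFun_gaussianMixture hμ
  -- The characteristic function is positive, hence its logarithm is the real one.
  refine ⟨⟨by linarith, by linarith⟩, Real.lt_sqrt_of_sq_lt (by simpa using hb),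
    hid.gaussianMixture hμ, fun z ↦ (Real.log (laplace μ z) : ℝ), ⟨?_, ?_, ?_⟩, ?_⟩
  · have hcont : Continuous (laplace μ) := by
      have : laplace μ = fun z ↦ (charFun (_root_.gaussianMixture μ) z).re := by
        ext z
        rw [hchar, Complex.ofReal_re]
      rw [this]
      exact Complex.continuous_re.comp continuous_charFun
    exact Complex.continuous_ofReal.comp (hcont.log fun z ↦ (laplace_pos μ z).ne')
  · have h0 := hchar 0
    rw [charFun_zero, probReal_univ] at h0
    have : laplace μ 0 = 1 := by exact_mod_cast h0.symm
    simp [this]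
  · intro z
    rw [hchar, ← Complex.ofReal_exp, Real.exp_log (laplace_pos μ z)]
  · intro z
    have hpow : √b ^ (2 * α) = b ^ α := by
      rw [Real.rpow_mul (Real.sqrt_nonneg b), Real.rpow_two, Real.sq_sqrt hb0]
    rw [hchar, hpow, ← laplace_map_smul μ hb0,
      ← laplace_rpow_eq hid hμ hψ (Real.rpow_nonneg hb0 α) hstable,
      Real.rpow_def_of_pos (laplace_pos μ z), mul_comm (Real.log _)]
    push_cast
    rfl

/-! ### Laws of random vectors -/

lemma map_sqrt_apply_eq_gaussianMixture {Ω : Type*} [MeasurableSpace Ω] {P : Measure Ω}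
    [IsProbabilityMeasure P] {X : Ω → EuclideanSpace ℝ (Fin d)}
    (hX : HasLaw X (stdGaussian (EuclideanSpace ℝ (Fin d))) P)
    {Z : Ω → Matrix (Fin d) (Fin d) ℝ} (hZ_meas : AEMeasurable (fun ω ↦ lowerTriangle (Z ω)) P)
    (hZ_psd : ∀ᵐ ω ∂P, (Z ω).PosSemidef)
    (hXZ : IndepFun X (fun ω ↦ lowerTriangle (Z ω)) P) :
    P.map (fun ω ↦ Matrix.toEuclideanCLM (𝕜 := ℝ) (CFC.sqrt (Z ω)) (X ω)) =
      gaussianMixture (P.map fun ω ↦ lowerTriangle (Z ω)) := by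
  have hjoint := (indepFun_iff_map_prod_eq_prod_map_map hZ_meas hX.aemeasurable).1 hXZ.symm
  rw [gaussianMixture, ← hX.map_eq, ← hjoint, AEMeasurable.map_map_of_aemeasurable
    measurable_sqrt_symMatrix_apply.aemeasurable (hZ_meas.prodMk hX.aemeasurable)]
  refine Measure.map_congr ?_
  filter_upwards [hZ_psd] with ω hω
  simp [symMatrix_lowerTriangle hω.isHermitian]

end

theorem proposition2 {Ω : Type*} [MeasurableSpace Ω] (P : Measure Ω) [IsProbabilityMeasure P]
    (d : ℕ)
    (X : Ω → EuclideanSpace ℝ (Fin d))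
    (hX : HasLaw X (stdGaussian (EuclideanSpace ℝ (Fin d))) P)
    (Z : Ω → Matrix (Fin d) (Fin d) ℝ)
    (hZ_meas : AEMeasurable (fun ω => lowerTriangle (Z ω)) P)
    (hZ_psd : ∀ᵐ ω ∂P, (Z ω).PosSemidef)
    (hZ_id : IsInfDivisible (P.map fun ω => lowerTriangle (Z ω)))
    (hXZ : IndepFun X (fun ω => lowerTriangle (Z ω)) P)
    (σ : Measure (EuclideanSpace ℝ (Fin d)))
    (hσ : σ = P.map fun ω => Matrix.toEuclideanCLM (𝕜 := ℝ) (CFC.sqrt (Z ω)) (X ω)) :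
    (∀ (m : ℕ∞) (b : ℝ), 1 < b →
      (P.map fun ω => lowerTriangle (Z ω)) ∈ classL (LowerSpace d) m b⁻¹ →
        σ ∈ classL (EuclideanSpace ℝ (Fin d)) m (b ^ (-(1 / 2) : ℝ))) ∧
    (∀ (α' b : ℝ), 0 < α' → α' ≤ 1 → 1 < b →
      IsStrictlySemistable α' b (P.map fun ω => lowerTriangle (Z ω)) →
        IsStrictlySemistable (2 * α') (b ^ (1 / 2 : ℝ)) σ) := by
  have hpsd : ∀ᵐ s ∂(P.map fun ω ↦ lowerTriangle (Z ω)), s ∈ psdCone d := by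
    rw [ae_map_iff (p := fun s ↦ s ∈ psdCone d) hZ_meas isClosed_psdCone.measurableSet]
    filter_upwards [hZ_psd] with ω hω
    rwa [psdCone, Set.mem_ofPred_eq, symMatrix_lowerTriangle hω.isHermitian]
  rw [hσ, map_sqrt_apply_eq_gaussianMixture hX hZ_meas hZ_psd hXZ]
  refine ⟨fun m b hb h ↦ ?_, fun α' b _ hα' _ h ↦ ?_⟩
  · have hsqrt : b ^ (-(1 / 2) : ℝ) = √b⁻¹ := by
      rw [Real.rpow_neg (by linarith), Real.sqrt_inv, Real.sqrt_eq_rpow]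
    rw [hsqrt]
    exact gaussianMixture_mem_classL m h hpsd
  · rw [← Real.sqrt_eq_rpow]
    exact h.gaussianMixture hα' hpsd
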